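/- Let $d\ge 1$ and $b\ge 0$ be integers, $c\ge 0$ real, and $\mathbf{B}_d(c)=\{v\in\mathbb{R}^d:\|v\|_2\le c\}$. A ($b$-bit, possibly randomized) compression scheme is a pair $(\mathcal{C},\hat v)$ of a randomized map $\mathcal{C}:\mathbf{B}_d(c)\to[2^b]=\{1,\dots,2^b\}$ and a randomized map $\hat v:[2^b]\to\mathbb{R}^d$ whose randomness is independent of that of $\mathcal{C}$. (Estimators with values in $\mathbf{B}_d(c)$ are a special case.) 1. Every $b$-bit compression scheme $(\mathcal{C},\hat v)$ satisfies $$\sup_{v\in\mathbf{B}_d(c)}\mathbb{E}\left[\|\hat v(\mathcal{C}(v))-v\|_2^2\right]\ \ge\ c^2\,2^{-2b/d}.$$ 2. There is a universal constant $C_0>0$, independent of $d$, $b$, $c$ and the scheme, such that for all $b<d$ every unbiased $b$-bit compression scheme, that is, every scheme such that for all $v\in\mathbf{B}_d(c)$ the vector $\hat v(\mathcal{C}(v))$ is integrable and $\mathbb{E}[\hat v(\mathcal{C}(v))]=v$, satisfies $$\sup_{v\in\mathbf{B}_d(c)}\mathbb{E}\left[\|\hat v(\mathcal{C}(v))-v\|_2^2\right]\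 \ge\ \frac{C_0\,c^2\,d}{b}.$$ (Here expectations may be $+\infty$. For $b=0$ the right-hand side of the second bound is read as $+\infty$ if $c>0$ and as $0$ if $c=0$.) -/

import Mathlib

open MeasureTheory
open scoped ENNReal

noncomputable section

/-- The closed Euclidean ball of radius `c` centred at the origin of `ℝ^d`. -/
abbrev EuclideanBall (d : ℕ) (c : ℝ) : Set (EuclideanSpace ℝ (Fin d)) :=
  Metric.closedBall 0 c

/-- A (possibly randomized) `b`-bit compression scheme on the ball of radius `c` in `ℝ^d`.
`compress v` is the law of the message produced from the input `v`, and `estimate m` is the law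
of the estimate produced from the message `m`. The estimator sees the input only through the
message, so its coins are independent of those of the compressor. A deterministic scheme is the
case of point masses. No measurability in `v` is required. -/
structure CompressionScheme (d b : ℕ) (c : ℝ) where
  compress : EuclideanBall d c → PMF (Fin (2 ^ b))
  estimate : Fin (2 ^ b) → ProbabilityMeasure (EuclideanSpace ℝ (Fin d))

namespace CompressionScheme

variable {d b : ℕ} {c : ℝ}

/-- The law of the reconstruction `v̂ (C v)`: the mixture of the laws of `v̂ m`, weighted with
the probabilities that `C v = m`. -/
def outputLaw (S : CompressionScheme d b c) (v : EuclideanBall d c) :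
    Measure (EuclideanSpace ℝ (Fin d)) :=
  ∑ m : Fin (2 ^ b), S.compress v m • (S.estimate m : Measure (EuclideanSpace ℝ (Fin d)))

instance isProbabilityMeasure_outputLaw (S : CompressionScheme d b c) (v : EuclideanBall d c) :
    IsProbabilityMeasure (S.outputLaw v) := by
  constructor
  have h := (S.compress v).tsum_coe
  rw [tsum_fintype] at h
  simpa [outputLaw, Measure.finsetSum_apply] using h

/-- The mean squared error `𝔼 ‖v̂ (C v) - v‖²` at the input `v`, with value `∞` allowed. -/
def mse (S : CompressionScheme d b c) (v : EuclideanBall d c) : ℝ≥0∞ :=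
  ∫⁻ y, ‖y - (v : EuclideanSpace ℝ (Fin d))‖ₑ ^ 2 ∂(S.outputLaw v)

/-- The worst-case mean squared error, over all inputs in the ball. -/
def worstCaseMSE (S : CompressionScheme d b c) : ℝ≥0∞ :=
  ⨆ v : EuclideanBall d c, S.mse v

/-- Unbiasedness: for every input `v` in the ball, the reconstruction is integrable and
`𝔼 [v̂ (C v)] = v`. -/
def IsUnbiased (S : CompressionScheme d b c) : Prop :=
  ∀ v : EuclideanBall d c, Integrable (fun y => y) (S.outputLaw v) ∧
    ∫ y, y ∂(S.outputLaw v) = (v : EuclideanSpace ℝ (Fin d))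

end CompressionScheme

end

/-! Both bounds are volume arguments. Replacing each random estimate by its mean `meanEstimate m`
does not increase the error (`sum_meanEstimate_sub_sq_le`). Since the best message does at least as
well as the average one, the `2 ^ b` means are centres of balls of radius `√MSE` covering the ball
of radius `c`. Comparing volumes (`sq_mul_two_rpow_le_of_covering`) gives the first bound.

For an unbiased scheme each `v` is a convex combination of the means, with variance at most the MSE.
Maurey's method (`exists_norm_sum_sub_sq_le`) then approximates `v` by an average of `n` means with
squared error `MSE / n`. There are `2 ^ (b * n)` such averages, so the covering bound yields `n * c²
* 2^(-2bn/d) ≤ MSE`; taking `n = ⌊d / b⌋` gives the second bound. -/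

open Finset in
/-- A ball of radius `c` in `ℝ^d` that is covered by `2 ^ k` balls of radius `√s` satisfies
`c² 2^(-2k/d) ≤ s`. -/
theorem sq_mul_two_rpow_le_of_covering {d k : ℕ} {c s : ℝ} (hd : 0 < d) (hc : 0 ≤ c)
    (hs : 0 ≤ s) {ι : Type*} [Fintype ι] (hι : Fintype.card ι = 2 ^ k)
    (z : ι → EuclideanSpace ℝ (Fin d))
    (hz : ∀ v ∈ Metric.closedBall (0 : EuclideanSpace ℝ (Fin d)) c, ∃ i, ‖z i - v‖ ^ 2 ≤ s) :
    c ^ 2 * (2 : ℝ) ^ (-(2 * (k : ℝ) / (d : ℝ))) ≤ s := by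
  have hd' : (d : ℝ) ≠ 0 := by positivity
  have hcover : Metric.closedBall (0 : EuclideanSpace ℝ (Fin d)) c ⊆
      ⋃ i, Metric.closedBall (z i) (√s) := fun v hv => by
    obtain ⟨i, hi⟩ := hz v hv
    refine Set.mem_iUnion.2 ⟨i, ?_⟩
    rw [Metric.mem_closedBall, dist_comm, dist_eq_norm]
    exact Real.le_sqrt_of_sq_le hi
  have hvol : volume (Metric.closedBall (0 : EuclideanSpace ℝ (Fin d)) c) ≤
      ∑ i, volume (Metric.closedBall (z i) (√s)) :=
    (measure_mono hcover).trans (measure_iUnion_fintype_le _ _)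
  simp only [Measure.addHaar_closedBall _ _ hc, Measure.addHaar_closedBall _ _ (Real.sqrt_nonneg s),
    finrank_euclideanSpace_fin, sum_const, card_univ, hι, nsmul_eq_mul, ← mul_assoc] at hvol
  rw [ENNReal.mul_le_mul_iff_left (Metric.measure_ball_pos _ _ one_pos).ne'
    measure_ball_lt_top.ne, ← ENNReal.ofReal_natCast, ← ENNReal.ofReal_mul (by positivity),
    ENNReal.ofReal_le_ofReal_iff (by positivity)] at hvol
  have hpow : ((2 : ℝ) ^ ((k : ℝ) / d)) ^ d = 2 ^ k := by
    rw [← Real.rpow_natCast, ← Real.rpow_mul two_pos.le, div_mul_cancel₀ _ hd', Real.rpow_natCast]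
  have hle : c ≤ (2 : ℝ) ^ ((k : ℝ) / d) * √s := by
    refine le_of_pow_le_pow_left₀ hd.ne' (by positivity) ?_
    rw [mul_pow, hpow]
    exact_mod_cast hvol
  calc c ^ 2 * (2 : ℝ) ^ (-(2 * (k : ℝ) / (d : ℝ)))
      ≤ ((2 : ℝ) ^ ((k : ℝ) / d) * √s) ^ 2 * (2 : ℝ) ^ (-(2 * (k : ℝ) / (d : ℝ))) := by gcongr
    _ = s := by
      rw [mul_pow, Real.sq_sqrt hs, ← Real.rpow_natCast, ← Real.rpow_mul two_pos.le, mul_right_comm,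
        ← Real.rpow_add two_pos]
      have : (k : ℝ) / d * (2 : ℕ) + -(2 * (k : ℝ) / d) = 0 := by push_cast; ring
      rw [this, Real.rpow_zero, one_mul]

/-- The squared bias is at most the mean squared error, also when the mean does not exist. -/
theorem enorm_integral_sub_sq_le {E : Type*} [NormedAddCommGroup E] [NormedSpace ℝ E]
    [CompleteSpace E] [MeasurableSpace E] [BorelSpace E] [SecondCountableTopology E]
    (μ : Measure E) [IsProbabilityMeasure μ] (v : E) :
    ‖(∫ y, y ∂μ) - v‖ₑ ^ 2 ≤ ∫⁻ y, ‖y - v‖ₑ ^ 2 ∂μ := by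
  have hmeas : AEStronglyMeasurable (fun y : E => y - v) μ := by fun_prop
  have hsq : eLpNorm (fun y : E => y - v) 2 μ ^ 2 = ∫⁻ y, ‖y - v‖ₑ ^ 2 ∂μ := by
    simpa using eLpNorm_nnreal_pow_eq_lintegral (f := fun y : E => y - v) (μ := μ) (p := 2)
      two_ne_zero
  by_cases hint : Integrable (fun y : E => y) μ
  · have hmean : (∫ y, y ∂μ) - v = ∫ y, (y - v) ∂μ := by
      rw [integral_sub hint (integrable_const v)]; simp
    rw [hmean, ← hsq]
    gcongr
    calc ‖∫ y, (y - v) ∂μ‖ₑ ≤ ∫⁻ y, ‖y - v‖ₑ ∂μ := enorm_integral_le_lintegral_enorm _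
      _ = eLpNorm (fun y : E => y - v) 1 μ := eLpNorm_one_eq_lintegral_enorm.symm
      _ ≤ eLpNorm (fun y : E => y - v) 2 μ :=
        eLpNorm_le_eLpNorm_of_exponent_le one_le_two hmeas
  -- Under a probability measure a finite second moment forces integrability, so here the right-hand
  -- side is `∞` and the default value `0` of the integral is harmless.
  · rcases eq_or_ne (eLpNorm (fun y : E => y - v) 2 μ) ∞ with htop | hfin
    · rw [← hsq, htop]; simp
    · refine absurd ?_ hint
      have h2 : MemLp (fun y : E => y - v) 2 μ := ⟨hmeas, hfin.lt_top⟩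
      simpa only [Pi.add_def, sub_add_cancel] using
        (h2.integrable one_le_two).add (integrable_const v)

/-- A weighted average is attained from below. -/
theorem exists_le_of_weighted_sum_le {ι : Type*} [Fintype ι] {p f : ι → ℝ} {M : ℝ}
    (hp : ∀ i, 0 ≤ p i) (hsum : ∑ i, p i = 1) (hM : ∑ i, p i * f i ≤ M) : ∃ i, f i ≤ M := by
  by_contra! hlt
  have hpos : ∃ i, 0 < p i := by
    by_contra! hle
    linarith [Finset.sum_nonpos fun i (_ : i ∈ Finset.univ) => hle i]
  obtain ⟨j, hj⟩ := hpos
  have : ∑ i, p i * M < ∑ i, p i * f i :=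
    Finset.sum_lt_sum (fun i _ => mul_le_mul_of_nonneg_left (hlt i).le (hp i))
      ⟨j, Finset.mem_univ j, mul_lt_mul_of_pos_left (hlt j) hj⟩
  rw [← Finset.sum_mul, hsum, one_mul] at this
  linarith

/-- Maurey's empirical method: a convex combination `v` of the points `x i` with variance at most
`M` is approximated by a sum of `n` of these points. -/
theorem exists_norm_sum_sub_sq_le {E : Type*} [NormedAddCommGroup E] [InnerProductSpace ℝ E]
    {ι : Type*} [Fintype ι] {p : ι → ℝ} {x : ι → E} {v : E} {M : ℝ}
    (hp : ∀ i, 0 ≤ p i) (hsum : ∑ i, p i = 1) (hmean : ∑ i, p i • x i = v)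
    (hM : ∑ i, p i * ‖x i - v‖ ^ 2 ≤ M) (n : ℕ) :
    ∃ s : Fin n → ι, ‖∑ j, (x (s j) - v)‖ ^ 2 ≤ n * M := by
  induction n with
  | zero => exact ⟨Fin.elim0, by simp⟩
  | succ n ih =>
    obtain ⟨s, hs⟩ := ih
    set w := ∑ j, (x (s j) - v)
    -- The deviations `x i - v` have weighted mean zero, so a random next point adds on average at
    -- most `M` to the squared norm; some point does no worse than the average.
    have hcross : ∑ i, p i * inner ℝ (x i - v) w = 0 := by
      simp_rw [← real_inner_smul_left, ← sum_inner, smul_sub, Finset.sum_sub_distrib,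
        ← Finset.sum_smul, hmean, hsum, one_smul, sub_self, inner_zero_left]
    have havg : ∑ i, p i * ‖x i - v + w‖ ^ 2 ≤ ((n + 1 : ℕ) : ℝ) * M := by
      have hexp : ∑ i, p i * ‖x i - v + w‖ ^ 2 =
          ∑ i, p i * ‖x i - v‖ ^ 2 + 2 * ∑ i, p i * inner ℝ (x i - v) w
            + (∑ i, p i) * ‖w‖ ^ 2 := by
        rw [Finset.mul_sum, Finset.sum_mul, ← Finset.sum_add_distrib, ← Finset.sum_add_distrib]
        refine Finset.sum_congr rfl fun i _ => ?_
        rw [norm_add_sq_real]; ring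
      rw [hexp, hcross, hsum]
      push_cast
      linarith
    obtain ⟨i, hi⟩ := exists_le_of_weighted_sum_le hp hsum havg
    exact ⟨Fin.cons i s, by
      simpa only [Fin.sum_univ_succ, Fin.cons_zero, Fin.cons_succ] using hi⟩

namespace CompressionScheme

variable {d b : ℕ} {c : ℝ}

/-- The mean of the estimate produced from the message `m`, or `0` if it does not exist. -/
noncomputable def meanEstimate (S : CompressionScheme d b c) (m : Fin (2 ^ b)) :
    EuclideanSpace ℝ (Fin d) :=
  ∫ y, y ∂(S.estimate m : Measure (EuclideanSpace ℝ (Fin d)))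

theorem sum_toReal_compress (S : CompressionScheme d b c) (v : EuclideanBall d c) :
    ∑ m, (S.compress v m).toReal = 1 := by
  rw [← ENNReal.toReal_sum fun m _ => (S.compress v).apply_ne_top m,
    ← tsum_fintype (L := .unconditional _), (S.compress v).tsum_coe, ENNReal.toReal_one]

theorem sum_meanEstimate_sub_sq_le (S : CompressionScheme d b c) (hS : S.worstCaseMSE ≠ ∞)
    (v : EuclideanBall d c) :
    ∑ m, (S.compress v m).toReal * ‖S.meanEstimate m - v‖ ^ 2 ≤ S.worstCaseMSE.toReal := by
  have hle : ∑ m, S.compress v m * ‖S.meanEstimate m - v‖ₑ ^ 2 ≤ S.worstCaseMSE := by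
    refine le_trans ?_ (le_iSup S.mse v)
    rw [mse, outputLaw, lintegral_finsetSum_measure]
    refine Finset.sum_le_sum fun m _ => ?_
    rw [lintegral_smul_measure, smul_eq_mul]
    gcongr
    exact enorm_integral_sub_sq_le _ _
  have hreal := ENNReal.toReal_mono hS hle
  rw [ENNReal.toReal_sum fun m _ => ENNReal.mul_ne_top ((S.compress v).apply_ne_top m)
    (ENNReal.pow_ne_top enorm_ne_top)] at hreal
  simpa using hreal

/-- A message of probability zero may have an estimate without a mean; its weight removes the
default value from the sum. -/
theorem IsUnbiased.sum_smul_meanEstimate {S : CompressionScheme d b c} (hS : S.IsUnbiased)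
    (v : EuclideanBall d c) : ∑ m, (S.compress v m).toReal • S.meanEstimate m = v := by
  obtain ⟨hint, hmean⟩ := hS v
  rw [outputLaw] at hint hmean
  rw [integral_finsetSum_measure (integrable_finsetSum_measure.1 hint)] at hmean
  simpa only [integral_smul_measure, meanEstimate] using hmean

theorem le_worstCaseMSE (hd : 0 < d) (hc : 0 ≤ c) (S : CompressionScheme d b c) :
    ENNReal.ofReal (c ^ 2 * (2 : ℝ) ^ (-(2 * (b : ℝ) / (d : ℝ)))) ≤ S.worstCaseMSE := by
  rcases eq_or_ne S.worstCaseMSE ∞ with htop | hfin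
  · simp [htop]
  refine ENNReal.ofReal_le_of_le_toReal ?_
  exact sq_mul_two_rpow_le_of_covering hd hc ENNReal.toReal_nonneg (Fintype.card_fin _)
    S.meanEstimate fun v hv => exists_le_of_weighted_sum_le (fun _ => ENNReal.toReal_nonneg)
      (S.sum_toReal_compress ⟨v, hv⟩) (S.sum_meanEstimate_sub_sq_le hfin ⟨v, hv⟩)

/-- Averaging `n` independent copies of an unbiased scheme divides its mean squared error by `n`
and multiplies its number of bits by `n`. -/
theorem IsUnbiased.mul_le_worstCaseMSE {S : CompressionScheme d b c} (hS : S.IsUnbiased)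
    (hd : 0 < d) (hc : 0 ≤ c) (hfin : S.worstCaseMSE ≠ ∞) {n : ℕ} (hn : 0 < n) :
    n * (c ^ 2 * (2 : ℝ) ^ (-(2 * ((b * n : ℕ) : ℝ) / (d : ℝ)))) ≤ S.worstCaseMSE.toReal := by
  have hn' : (0 : ℝ) < n := by exact_mod_cast hn
  rw [← le_div_iff₀' hn']
  -- The centres are the averages of `n` means, indexed by the `2 ^ (b * n)` message sequences.
  refine sq_mul_two_rpow_le_of_covering hd hc (by positivity) (ι := Fin n → Fin (2 ^ b))
    (by simp [pow_mul]) (fun s => (n : ℝ)⁻¹ • ∑ j, S.meanEstimate (s j)) fun v hv => ?_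
  obtain ⟨s, hs⟩ := exists_norm_sum_sub_sq_le (fun _ => ENNReal.toReal_nonneg)
    (S.sum_toReal_compress ⟨v, hv⟩) (hS.sum_smul_meanEstimate ⟨v, hv⟩)
    (S.sum_meanEstimate_sub_sq_le hfin ⟨v, hv⟩) n
  refine ⟨s, ?_⟩
  have hrw : (n : ℝ)⁻¹ • ∑ j, S.meanEstimate (s j) - v =
      (n : ℝ)⁻¹ • ∑ j, (S.meanEstimate (s j) - v) := by
    rw [Finset.sum_sub_distrib, smul_sub, Finset.sum_const, Finset.card_univ, Fintype.card_fin,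
      ← Nat.cast_smul_eq_nsmul ℝ, inv_smul_smul₀ hn'.ne']
  rw [hrw, norm_smul, mul_pow, Real.norm_of_nonneg (by positivity), le_div_iff₀ hn']
  calc ((n : ℝ)⁻¹ ^ 2 * ‖∑ j, (S.meanEstimate (s j) - v)‖ ^ 2) * n
      ≤ ((n : ℝ)⁻¹ ^ 2 * (n * S.worstCaseMSE.toReal)) * n := by gcongr
    _ = S.worstCaseMSE.toReal := by field_simp

/-- Without any communication only a ball of radius `0` has an unbiased scheme. -/
theorem IsUnbiased.radius_eq_zero {S : CompressionScheme d 0 c} (hS : S.IsUnbiased) (hd : 0 < d)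
    (hc : 0 ≤ c) : c = 0 := by
  have : Subsingleton (Fin (2 ^ 0)) := inferInstanceAs (Subsingleton (Fin 1))
  have hv : ∀ v : EuclideanBall d c, (v : EuclideanSpace ℝ (Fin d)) = S.meanEstimate 0 := by
    intro v
    have hsum := S.sum_toReal_compress v
    rw [Fintype.sum_subsingleton _ 0] at hsum
    rw [← hS.sum_smul_meanEstimate v, Fintype.sum_subsingleton _ 0, hsum, one_smul]
  let e : EuclideanSpace ℝ (Fin d) := EuclideanSpace.single ⟨0, hd⟩ c
  have he : ‖e‖ = c := by simp [e, abs_of_nonneg hc]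
  have h0 := hv ⟨0, by simpa using hc⟩
  have h1 := hv ⟨e, by simp [he]⟩
  rw [← he, norm_eq_zero]
  exact h1.trans h0.symm

theorem IsUnbiased.le_worstCaseMSE {S : CompressionScheme d b c} (hS : S.IsUnbiased)
    (hb : b < d) (hc : 0 ≤ c) :
    ENNReal.ofReal (1 / 8 * c ^ 2 * (d : ℝ)) / (b : ℝ≥0∞) ≤ S.worstCaseMSE := by
  have hd : 0 < d := by omega
  rcases Nat.eq_zero_or_pos b with rfl | hb0
  -- With `c = 0` the left-hand side is `0 / 0`, which is `0` in `ℝ≥0∞`.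
  · simp [hS.radius_eq_zero hd hc]
  rcases eq_or_ne S.worstCaseMSE ∞ with htop | hfin
  · simp [htop]
  have hb' : (0 : ℝ) < b := by exact_mod_cast hb0
  have hd' : (0 : ℝ) < d := by exact_mod_cast hd
  rw [← ENNReal.ofReal_natCast b, ← ENNReal.ofReal_div_of_pos hb']
  refine ENNReal.ofReal_le_of_le_toReal ?_
  -- With `n = ⌊d / b⌋`, `b * n ≤ d` keeps the power of two at least `1 / 4`, and `n ≥ 1` gives `n ≥
  -- d / (2b)`; together they give the constant `1 / 8`.
  have hn : 0 < d / b := Nat.div_pos hb.le hb0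
  refine le_trans ?_ (hS.mul_le_worstCaseMSE hd hc hfin hn)
  have hquarter : (1 / 4 : ℝ) ≤ (2 : ℝ) ^ (-(2 * ((b * (d / b) : ℕ) : ℝ) / (d : ℝ))) := by
    have hle : ((b * (d / b) : ℕ) : ℝ) ≤ d := by exact_mod_cast Nat.mul_div_le d b
    calc (1 / 4 : ℝ) = (2 : ℝ) ^ (-2 : ℝ) := by
          rw [Real.rpow_neg two_pos.le]; norm_num
      _ ≤ _ := Real.rpow_le_rpow_of_exponent_le one_le_two
        (neg_le_neg ((div_le_iff₀ hd').2 (by linarith)))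
  have hhalf : (d : ℝ) ≤ 2 * (d / b : ℕ) * b := by
    have hmod := Nat.div_add_mod d b
    have hlt := Nat.mod_lt d hb0
    have hmul : b * 1 ≤ b * (d / b) := Nat.mul_le_mul_left b hn
    have : d ≤ 2 * (b * (d / b)) := by omega
    calc (d : ℝ) ≤ ((2 * (b * (d / b)) : ℕ) : ℝ) := by exact_mod_cast this
      _ = 2 * (d / b : ℕ) * b := by push_cast; ring
  calc 1 / 8 * c ^ 2 * (d : ℝ) / b ≤ 1 / 8 * c ^ 2 * (2 * (d / b : ℕ) * b) / b := by gcongr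
    _ = (d / b : ℕ) * (c ^ 2 * (1 / 4)) := by field_simp; ring
    _ ≤ _ := by gcongr

end CompressionScheme

theorem mainTheorem2 :
    (∀ (d b : ℕ) (c : ℝ), 0 < d → 0 ≤ c → ∀ S : CompressionScheme d b c,
      ENNReal.ofReal (c ^ 2 * (2 : ℝ) ^ (-(2 * (b : ℝ) / (d : ℝ)))) ≤ S.worstCaseMSE) ∧
    ∃ C₀ : ℝ, 0 < C₀ ∧
      ∀ (d b : ℕ) (c : ℝ), b < d → 0 ≤ c → ∀ S : CompressionScheme d b c, S.IsUnbiased →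
        ENNReal.ofReal (C₀ * c ^ 2 * (d : ℝ)) / (b : ℝ≥0∞) ≤ S.worstCaseMSE :=
  ⟨fun _ _ _ hd hc S => S.le_worstCaseMSE hd hc,
    1 / 8, by norm_num, fun _ _ _ hb hc _ hS => hS.le_worstCaseMSE hb hc⟩
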